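/- Write $[n]=\{1,\dots,n\}$ and let $\Delta(S)$ denote the set of probability distributions on a finite set $S$. Let $N\ge 1$ and $C\ge 0$ be integers. For any choice of distributions $\gamma_{c,j}\in\Delta([N+C])$, one for each $c\in[C]$ and $j\in[N]$, with $\gamma_{c,j,k}$ denoting the probability that $\gamma_{c,j}$ assigns to $k\in[N+C]$, there exists a map $\beta:[C]\to\Delta([N])$ such that, for all $c\in[C]$ and $j\in[N]$, $$\beta(c)_j=\sum_{j'=1}^{N}\beta(c)_{j'}\left(\gamma_{c,j',j}+\sum_{c'=1}^{C}\gamma_{c,j',N+c'}\,\beta(c')_j\right).$$ -/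

import Mathlib

open MeasureTheory Metric Set

/-! The right-hand side is the law of this experiment: draw `j'` from `β c`, then `k` from `γ c j'`;
output `k` if `k ≤ N`, otherwise `k = N + c'` and a draw from `β c'` is output. So it is a
polynomial self-map of a product of simplices, and Brouwer's theorem for smooth maps gives `β`.
Brouwer is proved analytically. The integral over the ball of the Jacobian of `x + t v x` is
polynomial in `t` and equals the volume for small `t`, hence also at `t = 1`. A retraction onto the
sphere would have Jacobian zero, so none exists. -/

/-- The determinant of `1 + t A` at `t = 1` is a fixed affine combination of its values at any
`finrank + 1` distinct parameters. -/
theorem det_one_add_eq_sum_lagrange {E : Type*} [NormedAddCommGroup E] [NormedSpace ℝ E]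
    [FiniteDimensional ℝ E] {τ : ℕ → ℝ} (hτ : Function.Injective τ) (A : E →L[ℝ] E) :
    (1 + A).det = ∑ i ∈ Finset.range (Module.finrank ℝ E + 1),
      (Lagrange.basis (Finset.range (Module.finrank ℝ E + 1)) τ i).eval 1 *
        (1 + τ i • A).det := by
  classical
  set b := Module.finBasis ℝ E
  set M := LinearMap.toMatrix b b (A : E →ₗ[ℝ] E) with hM
  set p : Polynomial ℝ := ((Polynomial.X : Polynomial ℝ) • M.map Polynomial.C +
    (1 : Matrix (Fin (Module.finrank ℝ E)) (Fin (Module.finrank ℝ E)) ℝ).map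
      Polynomial.C).det with hp
  have hpeval : ∀ t : ℝ, p.eval t = (1 + t • A).det := by
    intro t
    have h1 : (1 + t • A).det = (t • M + 1).det := by
      rw [ContinuousLinearMap.det, ← LinearMap.det_toMatrix b, add_comm]
      congr 1
      simp [hM, LinearMap.toMatrix_one]
    rw [h1, hp, ← Polynomial.coe_evalRingHom, RingHom.map_det]
    congr 1
    ext i j
    by_cases h : i = j <;> simp [h, mul_comm t]
  have hdeg : p.degree < (Finset.range (Module.finrank ℝ E + 1)).card := by
    rw [Finset.card_range]
    refine lt_of_le_of_lt Polynomial.degree_le_natDegree ?_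
    have := Polynomial.natDegree_det_X_add_C_le M 1
    rw [Fintype.card_fin] at this
    exact_mod_cast Nat.lt_succ_of_le this
  have h := Lagrange.eq_interpolate hτ.injOn hdeg
  have h1 := congrArg (Polynomial.eval 1) h
  rw [hpeval, one_smul, Lagrange.interpolate_apply, Polynomial.eval_finsetSum] at h1
  rw [h1]
  refine Finset.sum_congr rfl fun i _ => ?_
  rw [Polynomial.eval_mul, Polynomial.eval_C, hpeval, mul_comm]

/-! ### Small perturbations of the identity and the Jacobian integral -/

theorem det_one_add_pos {E : Type*} [NormedAddCommGroup E] [NormedSpace ℝ E]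
    [FiniteDimensional ℝ E] {A : E →L[ℝ] E} (hA : ‖A‖ < 1) : 0 < (1 + A).det := by
  -- A kernel vector would be shortened by `A` yet satisfy `‖w‖ ≤ ‖A w‖`.
  have hne : ∀ s ∈ uIcc (0 : ℝ) 1, (1 + s • A).det ≠ 0 := by
    intro s hs h0
    rw [uIcc_of_le zero_le_one] at hs
    obtain ⟨w, hw, hw0⟩ := (Submodule.ne_bot_iff _).1 (LinearMap.bot_lt_ker_of_det_eq_zero h0).ne'
    have hw1 : w + s • A w = 0 := by simpa using hw
    have h2 : ‖w‖ ≤ ‖A‖ * ‖w‖ := by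
      calc ‖w‖ = ‖s • A w‖ := by conv_lhs => rw [eq_neg_of_add_eq_zero_left hw1, norm_neg]
        _ = s * ‖A w‖ := by rw [norm_smul, Real.norm_of_nonneg hs.1]
        _ ≤ 1 * ‖A w‖ := by gcongr; exact hs.2
        _ ≤ ‖A‖ * ‖w‖ := by rw [one_mul]; exact A.le_opNorm w
    have := norm_pos_iff.2 hw0
    nlinarith
  by_contra! hle
  have hcont : Continuous fun s : ℝ => (1 + s • A).det :=
    ContinuousLinearMap.continuous_det.comp (by fun_prop)
  have hmem : (0 : ℝ) ∈ uIcc (1 + (0 : ℝ) • A).det (1 + (1 : ℝ) • A).det := by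
    have h1 : (1 + (0 : ℝ) • A).det = 1 := by simp [ContinuousLinearMap.det]
    rw [h1, one_smul, mem_uIcc]
    exact Or.inr ⟨hle, zero_le_one⟩
  obtain ⟨s, hs, h0⟩ := intermediate_value_uIcc hcont.continuousOn hmem
  exact hne s hs h0

/-- A Lipschitz function on a closed ball vanishing on the sphere stays Lipschitz when extended
by zero. -/
theorem lipschitzWith_indicator_ball {E F : Type*} [NormedAddCommGroup E] [NormedSpace ℝ E]
    [NormedAddCommGroup F] {v : E → F} {R : ℝ} {K : NNReal}
    (hv : LipschitzOnWith K v (closedBall 0 R)) (hv0 : ∀ x, ‖x‖ = R → v x = 0) :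
    LipschitzWith K ((ball 0 R).indicator v) := by
  -- The segment from `x` to `y` crosses the sphere, where `v` vanishes, at a point no farther from
  -- `x` than `y`.
  have key : ∀ x ∈ ball (0 : E) R, ∀ y ∉ ball (0 : E) R, ‖v x‖ ≤ K * dist x y := by
    intro x hx y hy
    rw [mem_ball_zero_iff] at hx
    rw [mem_ball_zero_iff, not_lt] at hy
    have hcont : ContinuousOn (fun s : ℝ => ‖AffineMap.lineMap x y s‖) (uIcc 0 1) := by fun_prop
    have hmem : R ∈ uIcc ‖AffineMap.lineMap x y (0 : ℝ)‖ ‖AffineMap.lineMap x y (1 : ℝ)‖ := by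
      rw [AffineMap.lineMap_apply_zero, AffineMap.lineMap_apply_one, mem_uIcc]
      exact Or.inl ⟨hx.le, hy⟩
    obtain ⟨s, hs, hsR⟩ := intermediate_value_uIcc hcont hmem
    rw [uIcc_of_le zero_le_one] at hs
    have hd := hv.dist_le_mul x (by simpa using hx.le) (AffineMap.lineMap x y s)
      (by simpa using hsR.le)
    rw [hv0 _ hsR, dist_zero_right, dist_left_lineMap, Real.norm_of_nonneg hs.1] at hd
    refine hd.trans ?_
    gcongr
    exact mul_le_of_le_one_left dist_nonneg hs.2
  refine LipschitzWith.of_dist_le_mul fun x y => ?_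
  by_cases hx : x ∈ ball (0 : E) R <;> by_cases hy : y ∈ ball (0 : E) R
  · rw [indicator_of_mem hx, indicator_of_mem hy]
    exact hv.dist_le_mul x (ball_subset_closedBall hx) y (ball_subset_closedBall hy)
  · rw [indicator_of_mem hx, indicator_of_notMem hy, dist_zero_right]
    exact key x hx y hy
  · rw [indicator_of_notMem hx, indicator_of_mem hy, dist_zero_left, dist_comm]
    exact key y hy x hx
  · rw [indicator_of_notMem hx, indicator_of_notMem hy, dist_self]
    positivity

theorem bijective_id_add_of_lipschitzWith {E : Type*} [NormedAddCommGroup E] [CompleteSpace E]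
    {w : E → E} {K : NNReal} (hK : K < 1) (hw : LipschitzWith K w) :
    Function.Bijective fun x => x + w x := by
  constructor
  · intro x y hxy
    have h1 : x - y = w y - w x := by
      have : x + w x = y + w y := hxy
      rw [sub_eq_sub_iff_add_eq_add, this, add_comm]
    have h2 := hw.dist_le_mul y x
    rw [dist_eq_norm, ← h1, dist_comm, dist_eq_norm] at h2
    have hK' : (K : ℝ) < 1 := hK
    have h3 : ‖x - y‖ ≤ 0 := by nlinarith [norm_nonneg (x - y)]
    exact sub_eq_zero.1 (norm_le_zero_iff.1 h3)
  · intro y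
    have hc : ContractingWith K fun x => y - w x := by
      refine ⟨hK, LipschitzWith.of_dist_le_mul fun a b => ?_⟩
      rw [dist_sub_left]
      exact hw.dist_le_mul a b
    refine ⟨ContractingWith.fixedPoint _ hc, ?_⟩
    have := hc.fixedPoint_isFixedPt
    exact (eq_sub_iff_add_eq.1 this.symm)

/-- For a `C¹` field `v` vanishing on the sphere, the integral over the ball of the Jacobian
determinant of `x ↦ x + v x` is the volume of the ball. -/
theorem integral_det_one_add_fderiv {E : Type*} [NormedAddCommGroup E] [NormedSpace ℝ E]
    [FiniteDimensional ℝ E] [MeasurableSpace E] [BorelSpace E] (μ : Measure E)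
    [μ.IsAddHaarMeasure] {v : E → E} {R : ℝ}
    (hv : ∀ x ∈ closedBall (0 : E) R, ContDiffAt ℝ 1 v x) (hv0 : ∀ x, ‖x‖ = R → v x = 0) :
    ∫ x in ball (0 : E) R, (1 + fderiv ℝ v x).det ∂μ = μ.real (ball 0 R) := by
  obtain ⟨K, hK⟩ := ContDiffOn.exists_lipschitzOnWith
    (fun x hx => (hv x hx).contDiffWithinAt) one_ne_zero (convex_closedBall (0 : E) R)
    (isCompact_closedBall 0 R)
  have hfd : ∀ x ∈ ball (0 : E) R, HasFDerivAt v (fderiv ℝ v x) x := fun x hx =>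
    ((hv x (ball_subset_closedBall hx)).differentiableAt one_ne_zero).hasFDerivAt
  have hK' : ∀ x ∈ ball (0 : E) R, ‖fderiv ℝ v x‖ ≤ K := fun x hx =>
    norm_fderiv_le_of_lipschitzOn ℝ (closedBall_mem_nhds_of_mem hx) hK
  -- Extended by the identity, `x + t v x` is a bijection fixing the complement of the ball, so it
  -- maps the ball onto itself; apply change of variables.
  have small : ∀ t : NNReal, t * K < 1 →
      ∫ x in ball (0 : E) R, (1 + (t : ℝ) • fderiv ℝ v x).det ∂μ = μ.real (ball 0 R) := by
    intro t ht
    have hlip : LipschitzWith (t * K) ((ball (0 : E) R).indicator fun x => (t : ℝ) • v x) := by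
      refine lipschitzWith_indicator_ball (LipschitzOnWith.of_dist_le_mul fun x hx y hy => ?_)
        fun x hx => by rw [hv0 x hx, smul_zero]
      rw [dist_smul₀, Real.norm_of_nonneg t.coe_nonneg, NNReal.coe_mul, mul_assoc]
      exact mul_le_mul_of_nonneg_left (hK.dist_le_mul x hx y hy) t.2
    have hbij := bijective_id_add_of_lipschitzWith ht hlip
    set g : E → E := fun x => x + (ball (0 : E) R).indicator (fun x => (t : ℝ) • v x) x with hg
    have hgout : ∀ x ∉ ball (0 : E) R, g x = x := fun x hx => by
      simp only [hg, indicator_of_notMem hx, add_zero]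
    have himg : g '' ball 0 R = ball 0 R := by
      have hc : g '' (ball 0 R)ᶜ = (ball 0 R)ᶜ := by
        conv_rhs => rw [← image_id ((ball (0 : E) R)ᶜ)]
        exact image_congr fun x hx => hgout x hx
      rw [image_compl_eq hbij] at hc
      exact compl_injective hc
    have hder : ∀ x ∈ ball (0 : E) R,
        HasFDerivWithinAt g (1 + (t : ℝ) • fderiv ℝ v x) (ball 0 R) x := by
      intro x hx
      have h1 : HasFDerivAt (fun x => x + (t : ℝ) • v x) (1 + (t : ℝ) • fderiv ℝ v x) x :=
        (hasFDerivAt_id x).add ((hfd x hx).const_smul (t : ℝ))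
      exact h1.hasFDerivWithinAt.congr (fun y hy => by simp only [hg, indicator_of_mem hy])
        (by simp only [hg, indicator_of_mem hx])
    have hcv := integral_image_eq_integral_abs_det_fderiv_smul μ measurableSet_ball hder
      hbij.1.injOn fun _ => (1 : ℝ)
    rw [himg, setIntegral_const, smul_eq_mul, mul_one] at hcv
    rw [hcv]
    refine setIntegral_congr_fun measurableSet_ball fun x hx => ?_
    have hlt : ‖(t : ℝ) • fderiv ℝ v x‖ < 1 := by
      rw [norm_smul, Real.norm_of_nonneg t.coe_nonneg]
      exact lt_of_le_of_lt (mul_le_mul_of_nonneg_left (hK' x hx) t.2) (by exact_mod_cast ht)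
    simp only [smul_eq_mul, mul_one]
    exact (abs_of_pos (det_one_add_pos hlt)).symm
  -- Distinct interpolation nodes, all in the small range; `K + 1` covers `K = 0`.
  set τ : ℕ → NNReal := fun n => 1 / ((K + 1) * (n + 1)) with hτdef
  have hτ : Function.Injective fun n => (τ n : ℝ) := by
    intro m n hmn
    have h1 : τ m = τ n := NNReal.coe_injective hmn
    simp only [hτdef, one_div, inv_inj] at h1
    have h2 := mul_left_cancel₀ (by positivity : K + 1 ≠ 0) h1
    exact_mod_cast add_right_cancel h2
  have hτK : ∀ n, τ n * K < 1 := by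
    intro n
    simp only [hτdef]
    rw [one_div, inv_mul_lt_iff₀ (by positivity), mul_one]
    calc K < (K + 1) * 1 := by rw [mul_one]; exact lt_add_one K
      _ ≤ (K + 1) * (n + 1) := by gcongr; exact le_add_of_nonneg_left zero_le
  have hint : ∀ t : ℝ,
      IntegrableOn (fun x => (1 + t • fderiv ℝ v x).det) (ball (0 : E) R) μ := by
    intro t
    refine IntegrableOn.mono_set (ContinuousOn.integrableOn_compact
      (isCompact_closedBall (0 : E) R) fun x hx => ?_) ball_subset_closedBall
    have h1 : ContinuousAt (fderiv ℝ v) x :=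
      ((hv x hx).fderiv_right (m := 0) (by norm_num)).continuousAt
    have h2 : ContinuousAt (fun x => 1 + t • fderiv ℝ v x) x :=
      continuousAt_const.add (h1.const_smul t)
    exact (ContinuousLinearMap.continuous_det.continuousAt.comp h2).continuousWithinAt
  have hsum : ∑ i ∈ Finset.range (Module.finrank ℝ E + 1),
      (Lagrange.basis (Finset.range (Module.finrank ℝ E + 1)) (fun n => (τ n : ℝ)) i).eval 1
        = 1 := by
    rw [← Polynomial.eval_finsetSum, Lagrange.sum_basis hτ.injOn ⟨0, by simp⟩,
      Polynomial.eval_one]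
  rw [integral_congr_ae (ae_of_all _ fun x => det_one_add_eq_sum_lagrange hτ (fderiv ℝ v x)),
    integral_finsetSum _ fun i _ => (hint _).const_mul _]
  simp_rw [integral_const_mul]
  rw [Finset.sum_congr rfl fun i _ => by rw [small (τ i) (hτK i)], ← Finset.sum_mul, hsum,
    one_mul]

/-! ### No retraction, and Brouwer on the ball -/

/-- No `C¹` map of the ball has constant nonzero norm and restricts to the identity on the
sphere. -/
theorem not_norm_add_eq_of_contDiffAt {E : Type*} [NormedAddCommGroup E] [InnerProductSpace ℝ E]
    [FiniteDimensional ℝ E] {v : E → E} {R : ℝ} (hR : 0 < R)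
    (hv : ∀ x ∈ closedBall (0 : E) R, ContDiffAt ℝ 1 v x) (hv0 : ∀ x, ‖x‖ = R → v x = 0) :
    ¬ ∀ x ∈ ball (0 : E) R, ‖x + v x‖ = R := by
  intro hnorm
  let _ : MeasurableSpace E := borel E
  have : BorelSpace E := ⟨rfl⟩
  have h := integral_det_one_add_fderiv volume hv hv0
  rw [setIntegral_congr_fun (g := fun _ => (0 : ℝ)) measurableSet_ball, integral_zero] at h
  · have hpos : 0 < (volume : Measure E).real (ball 0 R) :=
      ENNReal.toReal_pos (measure_ball_pos _ _ hR).ne' measure_ball_lt_top.ne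
    exact hpos.ne h
  intro x hx
  by_contra hdet
  have hd : HasFDerivAt (fun x => x + v x) (1 + fderiv ℝ v x) x :=
    (hasFDerivAt_id x).add
      ((hv x (ball_subset_closedBall hx)).differentiableAt one_ne_zero).hasFDerivAt
  have hunit : IsUnit ((1 + fderiv ℝ v x : E →L[ℝ] E) : E →ₗ[ℝ] E) :=
    (LinearMap.isUnit_iff_isUnit_det _).2 (isUnit_iff_ne_zero.2 hdet)
  -- Differentiating the constant `‖x + v x‖ ^ 2` along this `w` gives `2 * R ^ 2 = 0`.
  obtain ⟨w, hw⟩ := ((Module.End.isUnit_iff _).1 hunit).2 (x + v x)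
  have hd1 := hd.inner ℝ hd
  have hd2 : HasFDerivAt (fun y => inner ℝ (y + v y) (y + v y)) (0 : E →L[ℝ] ℝ) x := by
    refine (hasFDerivAt_const (R ^ 2) x).congr_of_eventuallyEq ?_
    filter_upwards [isOpen_ball.mem_nhds hx] with y hy
    rw [real_inner_self_eq_norm_sq, hnorm y hy]
  have heq := DFunLike.congr_fun (hd1.unique hd2) w
  have hw' : (1 + fderiv ℝ v x) w = x + v x := hw
  simp only [ContinuousLinearMap.comp_apply, ContinuousLinearMap.prod_apply,
    fderivInnerCLM_apply, zero_apply, hw', real_inner_self_eq_norm_sq,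
    hnorm x hx] at heq
  nlinarith

/-- Brouwer's fixed point theorem for a `C¹` map into an open ball. -/
theorem exists_fixedPoint_of_contDiff {E : Type*} [NormedAddCommGroup E] [InnerProductSpace ℝ E]
    [FiniteDimensional ℝ E] {G : E → E} {R : ℝ} (hG : ContDiff ℝ 1 G) (hGR : ∀ x, ‖G x‖ < R) :
    ∃ x, G x = x := by
  by_contra! hne
  have hR : 0 < R := (norm_nonneg _).trans_lt (hGR 0)
  -- The ray from `G x` through `x` leaves the ball at `x + v x`: the coefficient in `v` is the
  -- larger root `s` of `‖x + s • (x - G x)‖ ^ 2 = R ^ 2`, with reduced discriminant `D`. Positivity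
  -- of `D` up to the sphere keeps the square root smooth.
  set a : E → ℝ := fun x => inner ℝ x (x - G x) with ha
  set q : E → ℝ := fun x => ‖x - G x‖ ^ 2 with hq
  set D : E → ℝ := fun x => a x ^ 2 + q x * (R ^ 2 - ‖x‖ ^ 2) with hD
  set v : E → E := fun x => ((-a x + √(D x)) / q x) • (x - G x) with hv
  have hqpos : ∀ x, 0 < q x := fun x =>
    pow_pos (norm_pos_iff.2 (sub_ne_zero.2 (hne x).symm)) 2
  have hapos : ∀ x, ‖x‖ = R → 0 < a x := by
    intro x hx
    have h1 : inner ℝ x (G x) ≤ ‖x‖ * ‖G x‖ := real_inner_le_norm x (G x)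
    have h2 := hGR x
    simp only [ha, inner_sub_right, real_inner_self_eq_norm_sq]
    rw [hx] at h1 ⊢
    nlinarith
  have hDpos : ∀ x ∈ closedBall (0 : E) R, 0 < D x := by
    intro x hx
    rw [mem_closedBall_zero_iff] at hx
    rcases hx.eq_or_lt with h | h
    · have := hapos x h
      simp only [hD, h, sub_self, mul_zero, add_zero]
      positivity
    · have h1 : 0 < R ^ 2 - ‖x‖ ^ 2 := by nlinarith [norm_nonneg x]
      have := mul_pos (hqpos x) h1
      simp only [hD]
      positivity
  refine not_norm_add_eq_of_contDiffAt (v := v) hR ?_ ?_ ?_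
  · intro x hx
    have hsub : ContDiff ℝ 1 fun x => x - G x := contDiff_id.sub hG
    have hac : ContDiff ℝ 1 a := contDiff_id.inner ℝ hsub
    have hqc : ContDiff ℝ 1 q := hsub.norm_sq ℝ
    have hDc : ContDiff ℝ 1 D :=
      (hac.pow 2).add (hqc.mul (contDiff_const.sub (contDiff_id.norm_sq ℝ)))
    exact ((hac.contDiffAt.neg.add (hDc.contDiffAt.sqrt (hDpos x hx).ne')).div hqc.contDiffAt
      (hqpos x).ne').smul hsub.contDiffAt
  · intro x hx
    have h1 : √(D x) = a x := by
      simp only [hD, hx, sub_self, mul_zero, add_zero]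
      exact Real.sqrt_sq (hapos x hx).le
    simp only [hv, h1, neg_add_cancel, zero_div, zero_smul]
  · intro x hx
    have hs := Real.sq_sqrt (hDpos x (ball_subset_closedBall hx)).le
    have hq0 := (hqpos x).ne'
    have hsq : ‖x + v x‖ ^ 2 = R ^ 2 := by
      have h1 : ‖v x‖ ^ 2 = ((-a x + √(D x)) / q x) ^ 2 * q x := by
        simp only [hv, norm_smul, mul_pow, hq, Real.norm_eq_abs, sq_abs]
      have h2 : inner ℝ x (v x) = (-a x + √(D x)) / q x * a x := by
        simp only [hv, inner_smul_right, ha]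
      rw [norm_add_sq_real, h1, h2]
      have h3 : √(D x) ^ 2 = a x ^ 2 + q x * (R ^ 2 - ‖x‖ ^ 2) := hs
      field_simp
      linear_combination h3
    exact (sq_eq_sq₀ (norm_nonneg _) hR.le).1 hsq

/-! ### From the ball to products of simplices -/

/-- The displacement attains its minimum on `s`, which must then be zero. -/
theorem IsCompact.exists_fixedPoint_of_forall_dist_lt {X : Type*} [MetricSpace X] {s : Set X}
    (hs : IsCompact s) {F : X → X} (hF : ContinuousOn F s)
    (h : ∀ δ > 0, ∃ x ∈ s, dist (F x) x < δ) : ∃ x ∈ s, F x = x := by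
  obtain ⟨x₀, hx₀, -⟩ := h 1 one_pos
  obtain ⟨x, hx, hmin⟩ := hs.exists_isMinOn ⟨x₀, hx₀⟩ 
    (continuous_dist.comp_continuousOn (hF.prodMk continuousOn_id))
  refine ⟨x, hx, ?_⟩
  by_contra hne
  obtain ⟨y, hy, hlt⟩ := h _ (dist_pos.2 hne)
  exact absurd (hmin hy) (not_le.2 hlt)

/-- A smooth positive approximation of the positive part. -/
noncomputable def smoothPosPart (ε x : ℝ) : ℝ := (x + √(x ^ 2 + 4 * ε ^ 2)) / 2

theorem smoothPosPart_pos {ε : ℝ} (hε : 0 < ε) (x : ℝ) : 0 < smoothPosPart ε x := by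
  have h : |x| < √(x ^ 2 + 4 * ε ^ 2) := by
    rw [← Real.sqrt_sq_eq_abs]
    exact Real.sqrt_lt_sqrt (sq_nonneg x) (by nlinarith)
  have := neg_abs_le x
  unfold smoothPosPart
  linarith

theorem le_smoothPosPart {ε x : ℝ} : x ≤ smoothPosPart ε x := by
  have h : x ≤ √(x ^ 2 + 4 * ε ^ 2) := Real.le_sqrt_of_sq_le (by nlinarith [sq_nonneg ε])
  unfold smoothPosPart
  linarith

theorem smoothPosPart_le {ε x : ℝ} (hε : 0 ≤ ε) (hx : 0 ≤ x) : smoothPosPart ε x ≤ x + ε := by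
  have h : √(x ^ 2 + 4 * ε ^ 2) ≤ x + 2 * ε :=
    Real.sqrt_le_iff.2 ⟨by positivity, by nlinarith⟩
  unfold smoothPosPart
  linarith

theorem contDiff_smoothPosPart {ε : ℝ} (hε : 0 < ε) : ContDiff ℝ 1 (smoothPosPart ε) := by
  unfold smoothPosPart
  refine ContDiff.div_const (contDiff_id.add (ContDiff.sqrt (by fun_prop) fun x => ?_)) 2
  positivity

/-- A smooth map to the simplex that is close to the identity on the simplex. -/
noncomputable def smoothSimplexRetract {κ : Type*} [Fintype κ] (ε : ℝ) (x : κ → ℝ) : κ → ℝ :=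
  fun j => smoothPosPart ε (x j) / ∑ k, smoothPosPart ε (x k)

section smoothSimplexRetract

variable {κ : Type*} [Fintype κ] [Nonempty κ] {ε : ℝ}

theorem sum_smoothPosPart_pos (hε : 0 < ε) (x : κ → ℝ) : 0 < ∑ k, smoothPosPart ε (x k) :=
  Finset.sum_pos (fun k _ => smoothPosPart_pos hε (x k)) Finset.univ_nonempty

theorem smoothSimplexRetract_mem (hε : 0 < ε) (x : κ → ℝ) :
    smoothSimplexRetract ε x ∈ stdSimplex ℝ κ := by
  refine ⟨fun j => (div_pos (smoothPosPart_pos hε _) (sum_smoothPosPart_pos hε x)).le, ?_⟩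
  simp only [smoothSimplexRetract]
  rw [← Finset.sum_div, div_self (sum_smoothPosPart_pos hε x).ne']

theorem contDiff_smoothSimplexRetract (hε : 0 < ε) :
    ContDiff ℝ 1 (smoothSimplexRetract ε : (κ → ℝ) → κ → ℝ) := by
  have h := contDiff_smoothPosPart hε
  refine contDiff_pi.2 fun j => ContDiff.div (h.comp (contDiff_apply ℝ ℝ j))
    (ContDiff.sum fun k _ => h.comp (contDiff_apply ℝ ℝ k)) fun x =>
      (sum_smoothPosPart_pos hε x).ne'

theorem dist_smoothSimplexRetract_le (hε : 0 < ε) {x : κ → ℝ} (hx : x ∈ stdSimplex ℝ κ) :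
    dist (smoothSimplexRetract ε x) x ≤ Fintype.card κ * ε := by
  refine (dist_pi_le_iff (by positivity)).2 fun j => ?_
  set S := ∑ k, smoothPosPart ε (x k) with hS
  have hcard : (1 : ℝ) ≤ Fintype.card κ := by exact_mod_cast Fintype.card_pos
  have hS1 : 1 ≤ S := by
    rw [← hx.2]
    exact Finset.sum_le_sum fun k _ => le_smoothPosPart
  have hS2 : S ≤ 1 + Fintype.card κ * ε := by
    calc S ≤ ∑ k, (x k + ε) := Finset.sum_le_sum fun k _ => smoothPosPart_le hε.le (hx.1 k)
      _ = 1 + Fintype.card κ * ε := by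
        rw [Finset.sum_add_distrib, hx.2, Finset.sum_const, Finset.card_univ, nsmul_eq_mul]
  have hx0 := hx.1 j
  have hx1 : x j ≤ 1 := by
    rw [← hx.2]
    exact Finset.single_le_sum (fun k _ => hx.1 k) (Finset.mem_univ j)
  have h1 : x j ≤ smoothPosPart ε (x j) := le_smoothPosPart
  have h2 := smoothPosPart_le hε.le hx0
  have hSpos : 0 < S := by linarith
  rw [Real.dist_eq, abs_le, smoothSimplexRetract, ← hS, neg_le_sub_iff_le_add,
    sub_le_iff_le_add, div_le_iff₀ hSpos, ← sub_le_iff_le_add, le_div_iff₀ hSpos]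
  constructor
  · nlinarith [mul_nonneg (by positivity : 0 ≤ Fintype.card κ * ε) (sub_nonneg.2 hS1),
      mul_nonneg hx0 (sub_nonneg.2 hS2),
      mul_nonneg (sub_nonneg.2 hx1) (by positivity : 0 ≤ Fintype.card κ * ε)]
  · nlinarith [mul_nonneg (by positivity : 0 ≤ Fintype.card κ * ε) (sub_nonneg.2 hS1),
      mul_nonneg hx0 (sub_nonneg.2 hS1), mul_nonneg hε.le (sub_nonneg.2 hcard)]

end smoothSimplexRetract

/-- Brouwer's fixed point theorem for smooth self-maps of a product of simplices. -/
theorem exists_fixedPoint_pi_stdSimplex {ι κ : Type*} [Fintype ι] [Fintype κ] [Nonempty κ]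
    {F : (ι → κ → ℝ) → ι → κ → ℝ} (hF : ContDiff ℝ 1 F)
    (hmaps : ∀ x, (∀ i, x i ∈ stdSimplex ℝ κ) → ∀ i, F x i ∈ stdSimplex ℝ κ) :
    ∃ x, (∀ i, x i ∈ stdSimplex ℝ κ) ∧ F x = x := by
  have hK : IsCompact (univ.pi fun _ : ι => stdSimplex ℝ κ) :=
    isCompact_univ_pi fun _ => isCompact_stdSimplex ℝ κ
  suffices h : ∃ x ∈ univ.pi fun _ : ι => stdSimplex ℝ κ, F x = x by
    simpa [mem_univ_pi] using h
  refine hK.exists_fixedPoint_of_forall_dist_lt hF.continuous.continuousOn fun δ hδ => ?_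
  have hcard : (0 : ℝ) < Fintype.card κ := by exact_mod_cast Fintype.card_pos
  obtain ⟨ε, hε, hεδ⟩ : ∃ ε : ℝ, 0 < ε ∧ Fintype.card κ * ε < δ :=
    ⟨δ / (2 * Fintype.card κ), by positivity, by field_simp; norm_num⟩
  set P : EuclideanSpace ℝ (ι × κ) → ι → κ → ℝ :=
    fun y i => smoothSimplexRetract ε fun j => y (i, j) with hP
  have hPmem : ∀ y i, P y i ∈ stdSimplex ℝ κ := fun y i => smoothSimplexRetract_mem hε _
  set G : EuclideanSpace ℝ (ι × κ) → EuclideanSpace ℝ (ι × κ) :=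
    fun y => WithLp.toLp 2 fun p => F (P y) p.1 p.2 with hG
  have hPc : ContDiff ℝ 1 P := contDiff_pi.2 fun i =>
    (contDiff_smoothSimplexRetract hε).comp (contDiff_pi.2 fun j => by fun_prop)
  have hGc : ContDiff ℝ 1 G := by
    refine contDiff_euclidean.2 fun p => ?_
    exact contDiff_pi.1 (contDiff_pi.1 (hF.comp hPc) p.1) p.2
  have hGb : ∀ y, ‖G y‖ < √(Fintype.card (ι × κ) + 1) := by
    intro y
    rw [EuclideanSpace.norm_eq]
    refine Real.sqrt_lt_sqrt (by positivity) (lt_of_le_of_lt ?_ (lt_add_one _))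
    calc ∑ p, ‖G y p‖ ^ 2 ≤ ∑ _p : ι × κ, (1 : ℝ) := by
          refine Finset.sum_le_sum fun p _ => ?_
          have hm := hmaps (P y) (hPmem y) p.1
          have h0 : 0 ≤ G y p := hm.1 p.2
          have h1 : G y p ≤ 1 := by
            rw [← hm.2]
            exact Finset.single_le_sum (fun k _ => hm.1 k) (Finset.mem_univ p.2)
          rw [Real.norm_of_nonneg h0]
          exact pow_le_one₀ h0 h1
      _ = Fintype.card (ι × κ) := by simp
  obtain ⟨y, hy⟩ := exists_fixedPoint_of_contDiff hGc hGb
  refine ⟨P y, fun i _ => hPmem y i, lt_of_le_of_lt ?_ hεδ⟩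
  -- The fixed point `y = F (P y)` lies in the product of simplices, where `P` moves points little;
  -- so `P y` is almost fixed by `F`.
  have hFy : ∀ i, F (P y) i = fun j => y (i, j) := fun i => by
    funext j
    conv_rhs => rw [← hy]
  refine (dist_pi_le_iff (by positivity)).2 fun i => ?_
  rw [dist_comm]
  have hm := hmaps (P y) (hPmem y) i
  rw [hFy i] at hm ⊢
  exact dist_smoothSimplexRetract_le hε hm

/-! ### The equilibrium equation -/

theorem mainTheorem11 (N C : ℕ) (hN : 1 ≤ N)
    (γ : Fin C → Fin N → Fin (N + C) → ℝ)
    (hγ : ∀ (c : Fin C) (j : Fin N), γ c j ∈ stdSimplex ℝ (Fin (N + C))) :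
    ∃ β : Fin C → Fin N → ℝ,
      (∀ c : Fin C, β c ∈ stdSimplex ℝ (Fin N)) ∧
      ∀ (c : Fin C) (j : Fin N),
        β c j = ∑ j' : Fin N, β c j' *
          (γ c j' (Fin.castAdd C j) +
            ∑ c' : Fin C, γ c j' (Fin.natAdd N c') * β c' j) := by
  have : Nonempty (Fin N) := ⟨⟨0, hN⟩⟩
  set F : (Fin C → Fin N → ℝ) → Fin C → Fin N → ℝ := fun β c j => ∑ j' : Fin N, β c j' *
    (γ c j' (Fin.castAdd C j) + ∑ c' : Fin C, γ c j' (Fin.natAdd N c') * β c' j) with hF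
  suffices hmaps : ∀ β, (∀ c, β c ∈ stdSimplex ℝ (Fin N)) →
      ∀ c, F β c ∈ stdSimplex ℝ (Fin N) by
    obtain ⟨β, hβ, hfix⟩ := exists_fixedPoint_pi_stdSimplex (by fun_prop) hmaps
    exact ⟨β, hβ, fun c j => (congrFun (congrFun hfix c) j).symm⟩
  intro β hβ c
  refine ⟨fun j => Finset.sum_nonneg fun j' _ => mul_nonneg ((hβ c).1 j') (add_nonneg
    ((hγ c j').1 _) (Finset.sum_nonneg fun c' _ => mul_nonneg ((hγ c j').1 _) ((hβ c').1 j))), ?_⟩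
  simp only [hF]
  rw [Finset.sum_comm]
  simp_rw [← Finset.mul_sum, Finset.sum_add_distrib]
  -- Writing `1` as the total mass of `β c` reduces the claim to each `j'`: the bracket summed over
  -- `j` is the total mass of `γ c j'`.
  rw [← (hβ c).2]
  refine Finset.sum_congr rfl fun j' _ => ?_
  rw [Finset.sum_comm]
  simp_rw [← Finset.mul_sum, (hβ _).2, mul_one]
  rw [← Fin.sum_univ_add, (hγ c j').2, mul_one]
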